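/- Let $G$ be an undirected graph, possibly with loops and parallel edges; subgraphs are identified with their edge sets. A *theta-subgraph* consists of two distinct vertices $u,v$ and three edge-disjoint paths from $u$ to $v$ that pairwise share no vertices other than $u$ and $v$. A *linear class* is a set $\mathcal{B}$ of cycles of $G$ such that no theta-subgraph of $G$ contains exactly two members of $\mathcal{B}$; cycles in $\mathcal{B}$ are *balanced* and all other cycles are *unbalanced*. The *lift matroid* $L(G,\mathcal{B})$ is the matroid on the edge set of $G$ whose circuits are: the balanced cycles; the theta-subgraphs that contain no balanced cycle; and the unions of two distinct unbalanced cycles with at most one vertex in common. For $r\ge 3$ let $\Delta_r$ be the graph obtained from a cycle with $r$ edges by replacing each edge with a parallel pair. For a non-negative integer $k$, let $\mathcal{S}_k$ be the class of all matroids that are isomorphic to a minor of $L(\Delta_r,\mathcal{B})$ for some $r\ge 3$ and some linear class $\mathcal{B}$ of at most $k$ Hamiltonian cycles of $\Delta_r$. **Lemma.** Let $k\ge 1$ be an integer. The number of non-isomorphic $2t$-element matroids in $\mathcal{S}_k$ is $O\left(t^{2^{k-1}+2}\right)$ as $t\to\infty$; that is, there are constants $c$ and $N$, depending only on $k$, such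 that this number is at most $c\,t^{2^{k-1}+2}$ for every integer $t>N$. -/

import Mathlib

namespace SpikeMinors

/-! ### Cycles, paths and theta-subgraphs of a multigraph, given by their edge sets -/

section Graphs

variable {V E : Type*}

/-- `C` is the edge set of a cycle of `G`. Loops are the cycles with one edge, and pairs of
parallel edges are the cycles with two edges. (In `Fin (n + 1)`, addition is cyclic.) -/
def IsCycle (G : Graph V E) (C : Set E) : Prop :=
  ∃ (n : ℕ) (v : Fin (n + 1) → V) (e : Fin (n + 1) → E),
    Function.Injective v ∧ Function.Injective e ∧
      (∀ i, G.IsLink (e i) (v i) (v (i + 1))) ∧ C = Set.range e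

/-- The set of vertices of `G` that are incident with an edge in `X`. -/
def vertices (G : Graph V E) (X : Set E) : Set V :=
  {x | ∃ e ∈ X, G.Inc e x}

/-- `C` is the edge set of a Hamiltonian cycle of `G`. -/
def IsHamiltonianCycle (G : Graph V E) (C : Set E) : Prop :=
  IsCycle G C ∧ vertices G C = G.vertexSet

/-- There is a path of `G` from `u` to `v` with vertex set `W` and edge set `P`. -/
def IsPath (G : Graph V E) (u v : V) (W : Set V) (P : Set E) : Prop :=
  ∃ (n : ℕ) (w : Fin (n + 1) → V) (e : Fin n → E),
    Function.Injective w ∧ w 0 = u ∧ w (Fin.last n) = v ∧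
      (∀ i : Fin n, G.IsLink (e i) (w i.castSucc) (w i.succ)) ∧
        W = Set.range w ∧ P = Set.range e

/-- `X` is the edge set of a theta-subgraph of `G`: two distinct vertices `u` and `v`, with three
(pairwise edge-disjoint) paths from `u` to `v` that pairwise share only the vertices `u`, `v`. -/
def IsTheta (G : Graph V E) (X : Set E) : Prop :=
  ∃ (u v : V) (W : Fin 3 → Set V) (P : Fin 3 → Set E),
    u ≠ v ∧ (∀ i, IsPath G u v (W i) (P i)) ∧
      (∀ i j, i ≠ j → W i ∩ W j = {u, v} ∧ Disjoint (P i) (P j)) ∧ X = ⋃ i, P i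

/-! ### Biased graphs and lift matroids -/

/-- `B` is a linear class of cycles of `G`: no theta-subgraph contains exactly two members
of `B`. The members of `B` are the balanced cycles. -/
def IsLinearClass (G : Graph V E) (B : Set (Set E)) : Prop :=
  (∀ C ∈ B, IsCycle G C) ∧ ∀ X, IsTheta G X → {C | C ∈ B ∧ C ⊆ X}.encard ≠ 2

/-- The circuits of the lift matroid of `(G, B)`: balanced cycles, theta-subgraphs none of whose
cycles is balanced, and pairs of unbalanced cycles with at most one common vertex. -/
def IsLiftCircuit (G : Graph V E) (B : Set (Set E)) (X : Set E) : Prop :=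
  (IsCycle G X ∧ X ∈ B) ∨
  (IsTheta G X ∧ ∀ C, IsCycle G C → C ⊆ X → C ∉ B) ∨
  (∃ C D, IsCycle G C ∧ IsCycle G D ∧ C ∉ B ∧ D ∉ B ∧ C ≠ D ∧
    (vertices G C ∩ vertices G D).encard ≤ 1 ∧ X = C ∪ D)

/-- `M` is the lift matroid `L(G, B)`. -/
def IsLiftMatroid (G : Graph V E) (B : Set (Set E)) (M : Matroid E) : Prop :=
  M.E = G.edgeSet ∧ ∀ X, M.IsCircuit X ↔ IsLiftCircuit G B X

end Graphs

/-! ### Spikes -/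

/-- The graph `Δ_r` obtained from a cycle with `r` edges by replacing each edge with a parallel
pair: the two edges `(i, true)` and `(i, false)` join the vertices `i` and `i + 1`. -/
def doubledCycle (r : ℕ) : Graph (ZMod r) (ZMod r × Bool) where
  vertexSet := Set.univ
  edgeSet := Set.univ
  IsLink e x y := s(x, y) = s(e.1, e.1 + 1)
  isLink_symm _ _ := ⟨fun x y h => by rw [Sym2.eq_swap]; exact h⟩
  eq_or_eq_of_isLink_of_isLink e x y v w h h' := by
    have h2 : s(x, y) = s(v, w) := h.trans h'.symm
    rcases Sym2.eq_iff.1 h2 with h3 | h3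
    · exact Or.inl h3.1
    · exact Or.inr h3.1
  edge_mem_iff_exists_isLink e := ⟨fun _ => ⟨e.1, e.1 + 1, rfl⟩, fun _ => Set.mem_univ _⟩
  left_mem_of_isLink _ _ _ _ := Set.mem_univ _

/-- `M` is a (tipless) spike `L(Δ_r, B)` with `r ≥ 3`, where `B` is a linear class of at most `k`
Hamiltonian cycles. -/
def IsSpikeWith (k r : ℕ) (M : Matroid (ZMod r × Bool)) : Prop :=
  3 ≤ r ∧ ∃ B : Set (Set (ZMod r × Bool)),
    IsLinearClass (doubledCycle r) B ∧ (∀ C ∈ B, IsHamiltonianCycle (doubledCycle r) C) ∧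
      B.encard ≤ k ∧ IsLiftMatroid (doubledCycle r) B M

/-! ### Isomorphism, and the classes `S_k` -/

/-- Isomorphism of matroids: a bijection between the ground sets that preserves independence in
both directions. -/
def Isomorphic {α β : Type*} (M : Matroid α) (N : Matroid β) : Prop :=
  ∃ f : M.E ≃ N.E, ∀ I : Set M.E,
    M.Indep (Subtype.val '' I) ↔ N.Indep (Subtype.val '' (f '' I))

theorem Isomorphic.refl {α : Type*} (M : Matroid α) : Isomorphic M M :=
  ⟨Equiv.refl _, fun I => by simp⟩

theorem Isomorphic.symm {α β : Type*} {M : Matroid α} {N : Matroid β} (h : Isomorphic M N) :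
    Isomorphic N M := by
  obtain ⟨f, hf⟩ := h
  refine ⟨f.symm, fun I => ?_⟩
  rw [hf, Equiv.image_symm_image]

theorem Isomorphic.trans {α β γ : Type*} {M : Matroid α} {N : Matroid β} {P : Matroid γ}
    (h : Isomorphic M N) (h' : Isomorphic N P) : Isomorphic M P := by
  obtain ⟨f, hf⟩ := h
  obtain ⟨g, hg⟩ := h'
  refine ⟨f.trans g, fun I => ?_⟩
  rw [hf, hg, Equiv.coe_trans, Set.image_comp]

/-- `M` belongs to `S_k`: it is isomorphic to a minor of a spike `L(Δ_r, B)`, where `B` contains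
at most `k` Hamiltonian cycles. -/
def MemS (k : ℕ) {α : Type*} (M : Matroid α) : Prop :=
  ∃ (r : ℕ) (L N : Matroid (ZMod r × Bool)),
    IsSpikeWith k r L ∧ N.IsMinor L ∧ Isomorphic M N

/-- The matroids in `S_k` with ground set `{0, …, n - 1}`. -/
abbrev LabelledS (k n : ℕ) : Type :=
  {M : Matroid (Fin n) // M.E = Set.univ ∧ MemS k M}

/-- Isomorphism, as an equivalence relation on the matroids in `S_k` with ground set
`{0, …, n - 1}`. -/
def isoSetoid (k n : ℕ) : Setoid (LabelledS k n) where
  r M N := Isomorphic M.1 N.1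
  iseqv := ⟨fun M => .refl M.1, fun h => h.symm, fun h h' => h.trans h'⟩

/-- The set of labelled matroids is finite, so that `Nat.card` below is the true cardinality. -/
theorem finite_labelledS (k n : ℕ) : Finite (LabelledS k n) := by
  refine Finite.of_injective
    (fun M : LabelledS k n => {I : Set (Fin n) | M.1.Indep I}) fun M N h => ?_
  refine Subtype.ext (Matroid.ext_indep (M.2.1.trans N.2.1.symm) fun I _ => ?_)
  exact Set.ext_iff.1 h I

/-- The number of non-isomorphic `n`-element matroids in `S_k`. -/
noncomputable def numS (k n : ℕ) : ℕ :=
  Nat.card (Quotient (isoSetoid k n))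

end SpikeMinors

/-! The cycles of Δ_r are its legs (parallel pairs) and its transversals. Hence a set is independent
in the spike iff it has an empty leg and at most one full leg, or meets every leg exactly once
without being a balanced transversal (`IsLiftMatroid.indep_iff`).

Let k = m + 1 and take a minor obtained by contracting an independent C and deleting D. Swapping the
two elements of a leg where needed, a leg that survives whole matters only through which of the
other m transversals differ there from the first: 2^m kinds. A leg with one survivor has two kinds,
its partner being deleted or contracted. The legs that vanish matter only through whether some leg
is wholly contracted, whether some leg is wholly deleted, and which balanced transversals are
destroyed. By `indep_image_relabel_iff` these data determine independence, so the isomorphism type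
depends only on two truth values, a subset of the m + 1 transversals, and the number of legs of each
of 2^m + 2 kinds. Each such number is at most the number of elements, which gives the exponent
(`numS_succ_le`). -/

namespace SpikeMinors

/-! ### Cycles and theta-subgraphs of the doubled cycle -/

section DoubledCycle

variable {r : ℕ}

/-- The vertices of `Δ_r` met when going from `i + 1` up to `j`; the edges between this set and its
complement are those at `i` and `j`. -/
def arc (i j : ZMod r) : Set (ZMod r) := {x | (x - (i + 1)).val ≤ (j - (i + 1)).val}

/-- The transversal of the parallel pairs of `Δ_r` that is selected by `τ`. -/
def transversal (τ : ZMod r → Bool) : Set (ZMod r × Bool) := {x | x.2 = τ x.1}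

theorem mem_transversal {τ : ZMod r → Bool} {x : ZMod r × Bool} :
    x ∈ transversal τ ↔ x.2 = τ x.1 := Iff.rfl

theorem transversal_injective :
    Function.Injective (transversal : (ZMod r → Bool) → Set (ZMod r × Bool)) := by
  intro τ σ h
  funext i
  have : (i, τ i) ∈ transversal σ := h ▸ rfl
  exact this

theorem isLink_doubledCycle {e : ZMod r × Bool} {x y : ZMod r} :
    (doubledCycle r).IsLink e x y ↔ (x = e.1 ∧ y = e.1 + 1) ∨ (x = e.1 + 1 ∧ y = e.1) :=
  Sym2.eq_iff

theorem val_add_one_of_ne [NeZero r] {z : ZMod r} (hz : z + 1 ≠ 0) : (z + 1).val = z.val + 1 := by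
  have h : z.val + 1 ≤ r := z.val_lt
  rcases h.lt_or_eq with h | h
  · have : z + 1 = ((z.val + 1 : ℕ) : ZMod r) := by simp
    rw [this, ZMod.val_natCast, Nat.mod_eq_of_lt h]
  · refine absurd ?_ hz
    have : z + 1 = ((z.val + 1 : ℕ) : ZMod r) := by simp
    rw [this, h, ZMod.natCast_self]

theorem mem_arc_add_one_iff [NeZero r] {i j x : ZMod r} (hi : x ≠ i) (hj : x ≠ j) :
    x + 1 ∈ arc i j ↔ x ∈ arc i j := by
  have h1 : x + 1 - (i + 1) = x - (i + 1) + 1 := by ring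
  have h2 : x - (i + 1) + 1 ≠ 0 := by
    intro h
    exact hi (sub_eq_zero.1 (by rw [← h]; ring))
  have h3 : (x - (i + 1)).val ≠ (j - (i + 1)).val := fun h =>
    hj (by simpa using ZMod.val_injective r h)
  simp only [arc, Set.mem_ofPred_eq, h1, val_add_one_of_ne h2]
  omega

theorem self_mem_arc {i j : ZMod r} : j ∈ arc i j := by simp [arc]

theorem add_one_notMem_arc [NeZero r] {i j : ZMod r} (h : j ≠ i) : j + 1 ∉ arc i j := by
  have h1 : j + 1 - (i + 1) = j - (i + 1) + 1 := by ring
  have h2 : j - (i + 1) + 1 ≠ 0 := by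
    intro h'
    exact h (sub_eq_zero.1 (by rw [← h']; ring))
  simp only [arc, Set.mem_ofPred_eq, h1, val_add_one_of_ne h2]
  omega

/-- Order the vertices as i + 1, i + 2, …, i. The arc that ends at the earlier of u and v contains
only that one. -/
theorem exists_arc_separating [NeZero r] (i : ZMod r) {u v : ZMod r} (huv : u ≠ v) :
    ∃ j, j ≠ i ∧ ¬(u ∈ arc i j ↔ v ∈ arc i j) := by
  have key : ∀ u v : ZMod r, (u - (i + 1)).val < (v - (i + 1)).val →
      ∃ j, j ≠ i ∧ ¬(u ∈ arc i j ↔ v ∈ arc i j) := by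
    intro u v h
    refine ⟨u, ?_, fun h' => ?_⟩
    -- The vertex i is last in the order, so it cannot precede v.
    · rintro rfl
      have h1 : u - (u + 1) = -1 := by ring
      obtain ⟨m, rfl⟩ := Nat.exists_eq_succ_of_ne_zero (NeZero.ne r)
      rw [h1, ZMod.val_neg_one] at h
      have := (v - (u + 1)).val_lt
      omega
    · have := h'.1 self_mem_arc
      simp only [arc, Set.mem_ofPred_eq] at this
      omega
  have hne : (u - (i + 1)).val ≠ (v - (i + 1)).val := fun h =>
    huv (by simpa using ZMod.val_injective r h)
  rcases hne.lt_or_gt with h | h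
  · exact key u v h
  · obtain ⟨j, hj, h'⟩ := key v u h
    exact ⟨j, hj, fun h'' => h' h''.symm⟩

/-- Injectivity on vertices forces the two parallel edges to be traversed in opposite directions, so
each follows the other cyclically. Thus 2 = 0 in the index group, and the cycle has no other edge.
-/
theorem IsCycle.eq_leg {C : Set (ZMod r × Bool)} (hC : IsCycle (doubledCycle r) C)
    {i : ZMod r} (h : ∀ c, (i, c) ∈ C) : C = {x | x.1 = i} := by
  obtain ⟨n, v, e, hv, he, hl, rfl⟩ := hC
  obtain ⟨a, ha⟩ := h true
  obtain ⟨b, hb⟩ := h false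
  have hab : a ≠ b := by
    rintro rfl
    simp [ha] at hb
  have h1 := isLink_doubledCycle.1 (hl a)
  have h2 := isLink_doubledCycle.1 (hl b)
  simp only [ha, hb] at h1 h2
  have h3 : v a = v (b + 1) ∧ v (a + 1) = v b := by
    rcases h1 with h1 | h1 <;> rcases h2 with h2 | h2
    · exact absurd (hv (h1.1.trans h2.1.symm)) hab
    · exact ⟨h1.1.trans h2.2.symm, h1.2.trans h2.1.symm⟩
    · exact ⟨h1.1.trans h2.2.symm, h1.2.trans h2.1.symm⟩
    · exact absurd (hv (h1.1.trans h2.1.symm)) hab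
  have h4 : a = b + 1 := hv h3.1
  have h5 : a + 1 = b := hv h3.2
  have h6 : (1 : Fin (n + 1)) + 1 = 0 := by
    have : a + (1 + 1) = a := by rw [← add_assoc, h5, h4]
    simpa using this
  have h7 : ∀ x : Fin (n + 1), x = a ∨ x = b := by
    rcases n with _ | _ | n
    · omega
    · intro x
      omega
    · rw [Fin.ext_iff, Fin.val_add] at h6
      have : 2 % (n + 1 + 1 + 1) = 0 := by simpa using h6
      rw [Nat.mod_eq_of_lt (by omega)] at this
      omega
  ext ⟨x, c⟩
  constructor
  · rintro ⟨y, hy⟩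
    rcases h7 y with rfl | rfl
    · simp_all
    · simp_all
  · rintro rfl
    exact h c

/-- A closed walk cannot cross a cut exactly once. As leg i is avoided, only edges of leg j can
cross the boundary of `arc i j`. -/
theorem IsCycle.twin_mem [NeZero r] {C : Set (ZMod r × Bool)}
    (hC : IsCycle (doubledCycle r) C) {i j : ZMod r} {c : Bool} (hi : ∀ c, (i, c) ∉ C)
    (hj : (j, c) ∈ C) : (j, !c) ∈ C := by
  classical
  by_contra hcon
  have hji : j ≠ i := by
    rintro rfl
    exact hi _ hj
  obtain ⟨n, v, e, hv, he, hl, rfl⟩ := hC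
  obtain ⟨a, ha⟩ := hj
  -- The increments of this indicator sum to 0 around the cycle, yet a lone crossing at `a` would
  -- contribute ±1.
  let g : Fin (n + 1) → ℤ := fun x => if v x ∈ arc i j then 1 else 0
  have h0 : ∑ x, (g (x + 1) - g x) = 0 := by
    rw [Finset.sum_sub_distrib, sub_eq_zero]
    exact Equiv.sum_comp (Equiv.addRight (1 : Fin (n + 1))) g
  have h1 : ∀ x, x ≠ a → g (x + 1) - g x = 0 := by
    intro x hx
    have hxi : (e x).1 ≠ i := fun h => hi (e x).2 ⟨x, by rw [← h]⟩
    have hxj : (e x).1 ≠ j := by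
      intro h
      have h2 : (e x).2 ≠ c := fun h' => hx (he (by rw [ha, ← h, ← h']))
      refine hcon ⟨x, Prod.ext h ?_⟩
      revert h2
      cases (e x).2 <;> cases c <;> simp
    have := mem_arc_add_one_iff hxi hxj
    rcases isLink_doubledCycle.1 (hl x) with h | h <;> simp [g, h.1, h.2, this]
  rw [Finset.sum_eq_single a (fun x _ => h1 x) (by simp)] at h0
  have h2 : j ∈ arc i j := self_mem_arc
  have h3 := add_one_notMem_arc hji
  rcases isLink_doubledCycle.1 (hl a) with h | h <;> simp [g, h.1, h.2, ha, h2, h3] at h0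

/-- A cycle of `Δ_r` is a parallel pair or a transversal. -/
theorem IsCycle.leg_or_transversal [NeZero r] {C : Set (ZMod r × Bool)}
    (hC : IsCycle (doubledCycle r) C) :
    (∃ i, C = {x | x.1 = i}) ∨ ∃ τ, C = transversal τ := by
  by_cases h : ∃ i, ∀ c, (i, c) ∈ C
  · obtain ⟨i, hi⟩ := h
    exact Or.inl ⟨i, hC.eq_leg hi⟩
  · right
    push Not at h
    have hne : ∀ i, ∃ c, (i, c) ∈ C := by
      intro i
      by_contra! hi
      obtain ⟨x, hx⟩ : C.Nonempty := by
        obtain ⟨n, v, e, -, -, -, rfl⟩ := hC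
        exact ⟨e 0, 0, rfl⟩
      obtain ⟨c, hc⟩ := h x.1
      have h1 : c ≠ x.2 := by
        rintro rfl
        exact hc hx
      have h2 := hC.twin_mem hi (j := x.1) (c := x.2) hx
      have h3 : c = !x.2 := by
        revert h1
        cases c <;> cases x.2 <;> simp
      exact hc (h3 ▸ h2)
    choose τ hτ using hne
    refine ⟨τ, Set.ext fun x => ⟨fun hx => ?_, fun hx => ?_⟩⟩
    · by_contra h1
      obtain ⟨c, hc⟩ := h x.1
      have h2 := hτ x.1
      rw [mem_transversal] at h1
      have : c = x.2 ∨ c = τ x.1 := by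
        revert h1
        cases c <;> cases x.2 <;> cases τ x.1 <;> simp
      rcases this with rfl | rfl
      · exact hc hx
      · exact hc h2
    · have := hτ x.1
      rw [← mem_transversal.1 hx] at this
      exact this

theorem isCycle_transversal [NeZero r] (τ : ZMod r → Bool) :
    IsCycle (doubledCycle r) (transversal τ) := by
  obtain ⟨n, rfl⟩ := Nat.exists_eq_succ_of_ne_zero (NeZero.ne r)
  refine ⟨n, id, fun i => (i, τ i), Function.injective_id, fun i j h => congrArg Prod.fst h,
    fun i => rfl, ?_⟩
  ext ⟨i, c⟩
  rw [mem_transversal, Set.mem_range]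
  constructor
  · intro h
    exact ⟨i, Prod.ext rfl h.symm⟩
  · rintro ⟨j, hj⟩
    rw [← hj]

theorem isCycle_leg (hr : 3 ≤ r) (i : ZMod r) : IsCycle (doubledCycle r) {x | x.1 = i} := by
  have : Fact (1 < r) := ⟨by omega⟩
  refine ⟨1, ![i, i + 1], ![(i, true), (i, false)], ?_, ?_, ?_, ?_⟩
  · intro a b
    fin_cases a <;> fin_cases b <;> simp
  · intro a b
    fin_cases a <;> fin_cases b <;> simp
  · intro a
    fin_cases a
    · exact isLink_doubledCycle.2 (Or.inl ⟨rfl, rfl⟩)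
    · exact isLink_doubledCycle.2 (Or.inr ⟨rfl, rfl⟩)
  · ext ⟨x, c⟩
    cases c <;> simp

theorem IsPath.exists_crossing {u v : ZMod r} {W : Set (ZMod r)} {P : Set (ZMod r × Bool)}
    (h : IsPath (doubledCycle r) u v W P) {S : Set (ZMod r)} (hS : ¬(u ∈ S ↔ v ∈ S)) :
    ∃ e ∈ P, ¬(e.1 + 1 ∈ S ↔ e.1 ∈ S) := by
  obtain ⟨n, w, e, -, rfl, rfl, hl, -, rfl⟩ := h
  by_contra! hcon
  refine hS ?_
  have : ∀ a, w 0 ∈ S ↔ w a ∈ S := by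
    intro a
    induction a using Fin.induction with
    | zero => rfl
    | succ a ih =>
      rw [ih]
      have h1 := hcon (e a) ⟨a, rfl⟩
      rcases isLink_doubledCycle.1 (hl a) with h | h <;> rw [h.1, h.2, h1]
  exact this _

/-- A theta-subgraph cannot be cut between its two branch vertices by two edges. -/
theorem IsTheta.not_subset_of_cut {X I : Set (ZMod r × Bool)} (hX : IsTheta (doubledCycle r) X)
    (hXI : X ⊆ I)
    (hcut : ∀ u v : ZMod r, u ≠ v → ∃ (S : Set (ZMod r)) (g : ZMod r × Bool → Bool),
      ¬(u ∈ S ↔ v ∈ S) ∧ Set.InjOn g {e | e ∈ I ∧ ¬(e.1 + 1 ∈ S ↔ e.1 ∈ S)}) : False := by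
  obtain ⟨u, v, W, P, huv, hP, hdis, rfl⟩ := hX
  obtain ⟨S, g, hS, hg⟩ := hcut u v huv
  choose e he hcross using fun a => (hP a).exists_crossing hS
  have hmem : ∀ a, e a ∈ {e | e ∈ I ∧ ¬(e.1 + 1 ∈ S ↔ e.1 ∈ S)} := fun a =>
    ⟨hXI (Set.mem_iUnion.2 ⟨a, he a⟩), hcross a⟩
  -- Three edge-disjoint paths need three crossing edges, but `g` has only two values to tell them
  -- apart.
  have hinj : Function.Injective fun a => g (e a) := by
    intro a b hab
    by_contra hne
    have := hg (hmem a) (hmem b) hab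
    exact Set.disjoint_left.1 (hdis a b hne).2 (he a) (this ▸ he b)
  have := Fintype.card_le_of_injective _ hinj
  simp at this

/-- With leg i absent, an arc separating the branch vertices is left only through the two edges of
one leg j. -/
theorem not_isTheta_of_subset_of_empty_leg [NeZero r] {X I : Set (ZMod r × Bool)} {i : ZMod r}
    (hi : ∀ c, (i, c) ∉ I) (hXI : X ⊆ I) : ¬IsTheta (doubledCycle r) X := by
  intro hX
  refine hX.not_subset_of_cut hXI fun u v huv => ?_
  obtain ⟨j, hji, hj⟩ := exists_arc_separating i huv
  have key : ∀ e : ZMod r × Bool, e ∈ {e | e ∈ I ∧ ¬(e.1 + 1 ∈ arc i j ↔ e.1 ∈ arc i j)} →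
      e.1 = j := by
    intro e he
    by_contra h
    exact he.2 (mem_arc_add_one_iff (fun h' => hi e.2 (h' ▸ he.1)) h)
  exact ⟨arc i j, Prod.snd, hj, fun e he f hf hef => Prod.ext ((key e he).trans (key f hf).symm) hef⟩

/-- At most two edges of a transversal leave the single vertex u, namely those on legs u and u - 1.
-/
theorem not_isTheta_of_subset_transversal {X : Set (ZMod r × Bool)} {τ : ZMod r → Bool}
    (hX : X ⊆ transversal τ) : ¬IsTheta (doubledCycle r) X := by
  classical
  intro h
  refine h.not_subset_of_cut hX fun u v huv =>
    ⟨{u}, fun e => decide (e.1 = u), by simp [huv.symm], ?_⟩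
  rintro ⟨x, c⟩ ⟨hx, hx'⟩ ⟨y, d⟩ ⟨hy, hy'⟩ hxy
  simp only [mem_transversal, Set.mem_singleton_iff, decide_eq_decide] at *
  have : x = y := by
    by_cases h : x = u
    · rw [h, hxy.1 h]
    · have h' : y ≠ u := fun h' => h (hxy.2 h')
      have h1 : x + 1 = u := by tauto
      have h2 : y + 1 = u := by tauto
      exact add_right_cancel (h1.trans h2.symm)
  subst this
  rw [hx, hy]

/-- A transversal with one more edge is a theta-subgraph of `Δ_r`. -/
theorem isTheta_transversal_union_leg (hr : 3 ≤ r) (τ : ZMod r → Bool) (i : ZMod r) :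
    IsTheta (doubledCycle r) (transversal τ ∪ {x | x.1 = i}) := by
  have : NeZero r := ⟨by omega⟩
  have : Fact (1 < r) := ⟨by omega⟩
  have hedge : ∀ c, IsPath (doubledCycle r) (i + 1) i {i + 1, i} {(i, c)} := by
    intro c
    refine ⟨1, ![i + 1, i], ![(i, c)], ?_, rfl, rfl, ?_, ?_, ?_⟩
    · intro a b
      fin_cases a <;> fin_cases b <;> simp
    · intro a
      fin_cases a
      exact isLink_doubledCycle.2 (Or.inr ⟨rfl, rfl⟩)
    · ext; simp [or_comm]
    · ext; simp
  -- The third path goes the long way round, through i + 1, i + 2, …, i + 1 + n = i, where r = n +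
  -- 1.
  have hlong : IsPath (doubledCycle r) (i + 1) i Set.univ (transversal τ \ {x | x.1 = i}) := by
    obtain ⟨n, rfl⟩ := Nat.exists_eq_succ_of_ne_zero (NeZero.ne r)
    have hinj : ∀ a b : ℕ, a < n + 1 → b < n + 1 →
        (i + 1 + a : ZMod (n + 1)) = i + 1 + b → a = b := by
      intro a b ha hb h
      have h := congrArg ZMod.val (add_left_cancel h)
      rwa [ZMod.val_natCast_of_lt ha, ZMod.val_natCast_of_lt hb] at h
    have hlast : i + 1 + (n : ZMod (n + 1)) = i := by
      have : ((n + 1 : ℕ) : ZMod (n + 1)) = 0 := ZMod.natCast_self _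
      push_cast at this
      rw [add_assoc, add_comm 1, this, add_zero]
    refine ⟨n, fun a => i + 1 + (a : ℕ), fun a => (i + 1 + (a : ℕ), τ (i + 1 + (a : ℕ))),
      fun a b h => Fin.ext (hinj a b a.2 b.2 h), by simp, by simpa using hlast, fun a => ?_, ?_, ?_⟩
    · refine isLink_doubledCycle.2 (Or.inl ⟨by simp, ?_⟩)
      simp [add_assoc]
    · symm
      rw [Set.range_eq_univ]
      intro x
      exact ⟨⟨(x - (i + 1)).val, ZMod.val_lt _⟩, by simp⟩
    · ext ⟨x, c⟩
      constructor
      · rintro ⟨hx, hxi⟩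
        have hval : i + 1 + (((x - (i + 1)).val : ℕ) : ZMod (n + 1)) = x := by simp
        have hlt : (x - (i + 1)).val < n := by
          refine lt_of_le_of_ne (Nat.lt_succ_iff.1 (ZMod.val_lt _)) fun h => hxi ?_
          rw [h] at hval
          exact hval.symm.trans hlast
        refine ⟨⟨_, hlt⟩, Prod.ext hval ?_⟩
        rw [mem_transversal] at hx
        simp only [hval]
        exact hx.symm
      · rintro ⟨a, ha⟩
        rw [Prod.mk.injEq] at ha
        refine ⟨?_, ?_⟩
        · rw [mem_transversal]
          exact ha.2.symm.trans (congrArg τ ha.1)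
        · intro h
          have h1 : i + 1 + ((a : ℕ) : ZMod (n + 1)) = i := ha.1.trans h
          have := hinj a n (by omega) (by omega) (h1.trans hlast.symm)
          omega
  have hne : i + 1 ≠ i := by simp
  refine ⟨i + 1, i, ![{i + 1, i}, {i + 1, i}, Set.univ],
    ![{(i, true)}, {(i, false)}, transversal τ \ {x | x.1 = i}], hne, ?_, ?_, ?_⟩
  · intro a
    fin_cases a
    · exact hedge _
    · exact hedge _
    · exact hlong
  · intro a b
    fin_cases a <;> fin_cases b <;> simp
  · ext ⟨x, c⟩
    simp only [Set.mem_union, Set.mem_iUnion, Fin.exists_fin_succ, Set.mem_ofPred_eq]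
    simp
    cases c <;> simp <;> tauto

theorem one_add_one_ne_zero_of_three_le (hr : 3 ≤ r) : (1 : ZMod r) + 1 ≠ 0 := by
  intro h
  have h3 : ((2 : ℕ) : ZMod r) = 0 := by rw [← h]; norm_num
  rw [ZMod.natCast_eq_zero_iff] at h3
  exact absurd (Nat.le_of_dvd (by norm_num) h3) (by omega)

/-- Two common vertices would give i = j + 1 and j = i + 1, hence 2 = 0 modulo r. This makes the
union of two unbalanced legs a circuit. -/
theorem encard_vertices_leg_inter (hr : 3 ≤ r) {i j : ZMod r} (hij : i ≠ j) :
    (vertices (doubledCycle r) {x | x.1 = i} ∩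
      vertices (doubledCycle r) {x | x.1 = j}).encard ≤ 1 := by
  have key : ∀ i x : ZMod r, x ∈ vertices (doubledCycle r) {x | x.1 = i} → x = i ∨ x = i + 1 := by
    rintro i x ⟨e, rfl, y, hy⟩
    have := isLink_doubledCycle.1 hy
    tauto
  have h2 := one_add_one_ne_zero_of_three_le hr
  rw [Set.encard_le_one_iff]
  rintro x y ⟨hx, hx'⟩ ⟨hy, hy'⟩
  have hx := key _ _ hx
  have hx' := key _ _ hx'
  have hy := key _ _ hy
  have hy' := key _ _ hy'
  by_contra hxy
  have h3 : i = j + 1 ∧ j = i + 1 := by grind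
  refine h2 ?_
  have : i + (1 + 1) = i := by rw [← add_assoc, ← h3.2, ← h3.1]
  simpa using this

end DoubledCycle

/-! ### Independent sets of a spike -/

section SpikeIndependence

variable {r : ℕ}

/-- The vertex i + 2 is missed. Hence legs are always unbalanced. -/
theorem not_isHamiltonianCycle_leg (hr : 3 ≤ r) (i : ZMod r) :
    ¬IsHamiltonianCycle (doubledCycle r) {x | x.1 = i} := by
  have : Fact (1 < r) := ⟨by omega⟩
  rintro ⟨-, h⟩
  have h1 : i + 1 + 1 ∈ vertices (doubledCycle r) {x | x.1 = i} := h ▸ Set.mem_univ _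
  obtain ⟨e, rfl, y, hy⟩ := h1
  have h2 := one_add_one_ne_zero_of_three_le hr
  rcases isLink_doubledCycle.1 hy with h | h
  · exact h2 (by simpa [add_assoc] using h.1)
  · simp at h

/-- Independence in a spike `L(Δ_r, B)`, leg by leg. -/
theorem IsLiftMatroid.indep_iff (hr : 3 ≤ r) {B : Set (Set (ZMod r × Bool))}
    (hB : ∀ C ∈ B, IsHamiltonianCycle (doubledCycle r) C) {M : Matroid (ZMod r × Bool)}
    (hM : IsLiftMatroid (doubledCycle r) B M) {I : Set (ZMod r × Bool)} :
    M.Indep I ↔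
      ((∀ i i', (∀ c, (i, c) ∈ I) → (∀ c, (i', c) ∈ I) → i = i') ∧ ∃ i, ∀ c, (i, c) ∉ I) ∨
      ((∀ i, ¬(∀ c, (i, c) ∈ I) ∧ ¬∀ c, (i, c) ∉ I) ∧
        ∀ τ, transversal τ ∈ B → ∃ i, (i, τ i) ∉ I) := by
  have : NeZero r := ⟨by omega⟩
  have hleg : ∀ i, {x : ZMod r × Bool | x.1 = i} ∉ B := fun i h =>
    not_isHamiltonianCycle_leg hr i (hB _ h)
  rw [Matroid.indep_iff_forall_subset_not_isCircuit (by rw [hM.1]; exact Set.subset_univ _)]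
  simp only [hM.2]
  constructor
  · intro h
    by_cases hempty : ∃ i, ∀ c, (i, c) ∉ I
    · refine Or.inl ⟨fun i i' hi hi' => ?_, hempty⟩
      by_contra hne
      refine h ({x | x.1 = i} ∪ {x | x.1 = i'}) ?_ (Or.inr (Or.inr ⟨_, _, isCycle_leg hr i,
        isCycle_leg hr i', hleg i, hleg i', fun heq => hne ?_,
        encard_vertices_leg_inter hr hne, rfl⟩))
      · rintro ⟨x, c⟩ (rfl | rfl)
        · exact hi c
        · exact hi' c
      · have : (i, true) ∈ {x : ZMod r × Bool | x.1 = i'} := heq ▸ rfl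
        exact this
    · refine Or.inr ⟨fun i => ⟨fun hi => ?_, fun hi => hempty ⟨i, hi⟩⟩, fun τ hτ => ?_⟩
      · push Not at hempty
        choose τ hτ using hempty
        -- This theta-subgraph is a circuit unless it contains a balanced cycle, which is then
        -- itself a circuit inside `I`.
        have hsub : transversal τ ∪ {x | x.1 = i} ⊆ I := by
          rintro ⟨x, c⟩ (hx | rfl)
          · rw [mem_transversal] at hx
            simp only at hx
            exact hx ▸ hτ x
          · exact hi c
        refine h _ hsub (Or.inr (Or.inl ⟨isTheta_transversal_union_leg hr τ i,
          fun C hC hCX hCB => h C (hCX.trans hsub) (Or.inl ⟨hC, hCB⟩)⟩))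
      · by_contra! hcon
        refine h (transversal τ) ?_ (Or.inl ⟨isCycle_transversal τ, hτ⟩)
        rintro ⟨x, c⟩ hx
        rw [mem_transversal] at hx
        simp only at hx
        exact hx ▸ hcon x
  · rintro (⟨huniq, i, hi⟩ | ⟨hone, hbal⟩) X hXI hX
    · have hcyc : ∀ C, IsCycle (doubledCycle r) C → C ⊆ I → ∃ j, C = {x | x.1 = j} := by
        intro C hC hCI
        rcases hC.leg_or_transversal with h | ⟨τ, rfl⟩
        · exact h
        · exact absurd (hCI (mem_transversal.2 rfl)) (hi (τ i))
      rcases hX with ⟨hC, hCB⟩ | ⟨hT, -⟩ | ⟨C, D, hC, hD, -, -, hne, -, rfl⟩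
      · obtain ⟨j, rfl⟩ := hcyc X hC hXI
        exact hleg j hCB
      · exact not_isTheta_of_subset_of_empty_leg hi hXI hT
      · obtain ⟨j, rfl⟩ := hcyc C hC (Set.subset_union_left.trans hXI)
        obtain ⟨j', rfl⟩ := hcyc D hD (Set.subset_union_right.trans hXI)
        refine hne ?_
        rw [huniq j j' (fun c => hXI (Or.inl rfl)) (fun c => hXI (Or.inr rfl))]
    · have hcyc : ∀ C, IsCycle (doubledCycle r) C → C ⊆ I → ∃ τ, C = transversal τ := by
        intro C hC hCI
        rcases hC.leg_or_transversal with ⟨j, rfl⟩ | h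
        · exact absurd (fun c => hCI rfl) (hone j).1
        · exact h
      have hsub : ∀ τ, transversal τ ⊆ I → I = transversal τ := by
        refine fun τ hτ => Set.Subset.antisymm ?_ hτ
        rintro ⟨x, c⟩ hx
        by_contra hc
        refine (hone x).1 fun d => ?_
        have h1 : (x, τ x) ∈ I := hτ (mem_transversal.2 rfl)
        rw [mem_transversal] at hc
        have : d = c ∨ d = τ x := by
          revert hc
          cases d <;> cases c <;> cases τ x <;> simp
        rcases this with rfl | rfl
        · exact hx
        · exact h1
      rcases hX with ⟨hC, hCB⟩ | ⟨hT, -⟩ | ⟨C, D, hC, hD, -, -, hne, -, rfl⟩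
      · obtain ⟨τ, rfl⟩ := hcyc X hC hXI
        obtain ⟨i, hi⟩ := hbal τ hCB
        exact hi (hXI (mem_transversal.2 rfl))
      · have h : ∀ i, ∃ c, (i, c) ∈ I := fun i => not_forall_not.1 (hone i).2
        choose τ hτ using h
        have hIτ : transversal τ ⊆ I := by
          rintro ⟨x, c⟩ hx
          rw [mem_transversal] at hx
          simp only at hx
          exact hx ▸ hτ x
        exact not_isTheta_of_subset_transversal (hXI.trans (hsub τ hIτ).subset) hT
      · have hCI := Set.subset_union_left.trans hXI
        have hDI := Set.subset_union_right.trans hXI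
        obtain ⟨τ, rfl⟩ := hcyc C hC hCI
        obtain ⟨σ, rfl⟩ := hcyc D hD hDI
        exact hne ((hsub τ hCI).symm.trans (hsub σ hDI))

/-- A spike, given by a numbering of its balanced transversals. -/
theorem IsSpikeWith.exists_indep_iff {k : ℕ} {L : Matroid (ZMod r × Bool)}
    (h : IsSpikeWith k r L) :
    ∃ (b : Fin k → ZMod r → Bool) (A : Set (Fin k)), ∀ I, L.Indep I ↔
      ((∀ i i', (∀ c, (i, c) ∈ I) → (∀ c, (i', c) ∈ I) → i = i') ∧ ∃ i, ∀ c, (i, c) ∉ I) ∨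
      ((∀ i, ¬(∀ c, (i, c) ∈ I) ∧ ¬∀ c, (i, c) ∉ I) ∧ ∀ j ∈ A, ∃ i, (i, b j i) ∉ I) := by
  classical
  obtain ⟨hr, B, -, hham, hcard, hL⟩ := h
  have hS : {τ : ZMod r → Bool | transversal τ ∈ B}.encard ≤ k :=
    (Set.encard_le_encard_of_injOn (f := transversal) (fun _ h => h)
      transversal_injective.injOn).trans hcard
  set S := {τ : ZMod r → Bool | transversal τ ∈ B}
  have hfin : Finite S := Set.finite_of_encard_le_coe hS
  have hle : Nat.card S ≤ k := by
    rw [← (Set.toFinite S).cast_ncard_eq] at hS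
    exact_mod_cast hS
  let f : S → Fin k := fun τ => Fin.castLE hle (Finite.equivFin S τ)
  have hf : Function.Injective f :=
    (Fin.castLE_injective hle).comp (Finite.equivFin S).injective
  -- Unused indices get an arbitrary transversal, which is harmless because they lie outside
  -- `Set.range f`.
  refine ⟨fun j => if h : ∃ τ : S, f τ = j then h.choose.1 else fun _ => true, Set.range f,
    fun I => ?_⟩
  rw [hL.indep_iff hr hham, Set.forall_mem_range]
  have hb : ∀ τ : S, (if h : ∃ σ : S, f σ = f τ then h.choose.1 else fun _ => true) = τ.1 := by
    intro τ
    have h : ∃ σ : S, f σ = f τ := ⟨τ, rfl⟩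
    rw [dif_pos h, hf h.choose_spec]
  simp only [hb]
  exact or_congr Iff.rfl (and_congr Iff.rfl ⟨fun h τ => h τ.1 τ.2, fun h τ hτ => h ⟨τ, hτ⟩⟩)

end SpikeIndependence

/-! ### Kinds of legs and the model of a minor -/

section Model

variable {m : ℕ} {ι : Type*}

/-- The kinds of legs that survive in a minor of a spike with `m + 1` numbered transversals:
`inl τ` is a leg with both elements, where `τ` records which transversals differ from the first one;
`inr true` and `inr false` are legs with one element deleted, or contracted. -/
abbrev LegKind (m : ℕ) : Type := (Fin m → Bool) ⊕ Bool

/-- The pairs `(y, c)` that label elements, for legs of the given kinds. -/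
def groundOf (st : ι → LegKind m) : Set (ι × Bool) :=
  {x | ∀ s, st x.1 = Sum.inr s → x.2 = false}

/-- The leg `y` is full once the contracted elements are added to `J`. -/
def IsFull (st : ι → LegKind m) (J : Set (ι × Bool)) (y : ι) : Prop :=
  st y ≠ Sum.inr true ∧ (y, false) ∈ J ∧ (st y ≠ Sum.inr false → (y, true) ∈ J)

/-- The leg `y` is empty even after the contracted elements are added to `J`. -/
def IsVacant (st : ι → LegKind m) (J : Set (ι × Bool)) (y : ι) : Prop :=
  st y ≠ Sum.inr false ∧ (y, false) ∉ J ∧ (st y ≠ Sum.inr true → (y, true) ∉ J)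

/-- Independence in a minor of a spike: `q₁` and `q₂` say that some leg is contracted, or
deleted, and `A` is the set of balanced transversals that survive. -/
def ModelIndep (st : ι → LegKind m) (q₁ q₂ : Prop) (A : Set (Fin (m + 1)))
    (J : Set (ι × Bool)) : Prop :=
  ((q₁ → ∀ y, ¬IsFull st J y) ∧ (∀ y y', IsFull st J y → IsFull st J y' → y = y') ∧
    (q₂ ∨ ∃ y, IsVacant st J y)) ∨
  (¬q₁ ∧ ¬q₂ ∧ (∀ y, ¬IsFull st J y ∧ ¬IsVacant st J y) ∧
    ∀ j ∈ A, ∃ y τ, st y = Sum.inl τ ∧ (y, (Fin.cons false τ : Fin (m + 1) → Bool) j) ∉ J)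

/-- The leg `i` of a spike with contracted set `C` and deleted set `D` is of kind `s`, and its
surviving elements are numbered from `p`. -/
def HasKind {I : Type*} (b : Fin (m + 1) → I → Bool) (C D : Set (I × Bool)) (i : I) (p : Bool) :
    LegKind m → Prop
  | Sum.inl τ => (∀ c, (i, c) ∉ C ∪ D) ∧
      ∀ j, b j i = xor ((Fin.cons false τ : Fin (m + 1) → Bool) j) p
  | Sum.inr true => (i, p) ∉ C ∪ D ∧ (i, !p) ∈ D
  | Sum.inr false => (i, p) ∉ C ∪ D ∧ (i, !p) ∈ C

theorem exists_hasKind {I : Type*} (b : Fin (m + 1) → I → Bool) (C D : Set (I × Bool)) (i : I)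
    (h : ∃ c, (i, c) ∉ C ∪ D) : ∃ p s, HasKind b C D i p s := by
  obtain ⟨p, hp⟩ := h
  by_cases hD : (i, !p) ∈ D
  · exact ⟨p, Sum.inr true, hp, hD⟩
  by_cases hC : (i, !p) ∈ C
  · exact ⟨p, Sum.inr false, hp, hC⟩
  -- On a whole leg the label `false` goes to the element of transversal 0, so only differences from
  -- that transversal are recorded.
  refine ⟨b 0 i, Sum.inl fun j => xor (b j.succ i) (b 0 i), fun c => ?_, fun j => ?_⟩
  · have : c = p ∨ c = !p := by cases c <;> cases p <;> simp
    rcases this with rfl | rfl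
    · exact hp
    · rintro (h | h)
      · exact hC h
      · exact hD h
  · induction j using Fin.cases with
    | zero => simp
    | succ j => simp

/-! ### From a minor to its model -/

section Relabel

variable {I : Type*} {b : Fin (m + 1) → I → Bool} {C D : Set (I × Bool)} {leg : ι → I}
  {p : ι → Bool} {st : ι → LegKind m}

/-- The element of the spike with label `(y, c)`. -/
def relabel (leg : ι → I) (p : ι → Bool) (x : ι × Bool) : I × Bool := (leg x.1, xor x.2 (p x.1))

theorem relabel_injective (hleg : Function.Injective leg) :
    Function.Injective (relabel leg p) := by
  rintro ⟨y, c⟩ ⟨y', c'⟩ h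
  simp only [relabel, Prod.mk.injEq] at h
  obtain rfl := hleg h.1
  simpa using h.2

theorem relabel_mem_iff (hst : ∀ y, HasKind b C D (leg y) (p y) (st y)) {x : ι × Bool} :
    x ∈ groundOf st ↔ relabel leg p x ∉ C ∪ D := by
  obtain ⟨y, c⟩ := x
  have h := hst y
  simp only [groundOf, relabel, Set.mem_ofPred_eq]
  rcases hs : st y with τ | _ | _ <;> rw [hs] at h
  · simpa using h.1 _
  all_goals
    cases c
    · simpa using h.1
    · simp [h.2]

theorem image_relabel_groundOf (hst : ∀ y, HasKind b C D (leg y) (p y) (st y))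
    (hran : ∀ i, i ∉ Set.range leg → ∀ c, (i, c) ∈ C ∪ D) :
    relabel leg p '' groundOf st = (C ∪ D)ᶜ := by
  ext ⟨i, c⟩
  constructor
  · rintro ⟨x, hx, hxi⟩
    rw [← hxi]
    exact (relabel_mem_iff hst).1 hx
  · intro h
    have hi : i ∈ Set.range leg := by
      by_contra hi
      exact h (hran i hi c)
    obtain ⟨y, rfl⟩ := hi
    have hx : relabel leg p (y, xor c (p y)) = (leg y, c) := by simp [relabel]
    exact ⟨_, (relabel_mem_iff hst).2 (hx ▸ h), hx⟩

variable {J : Set (ι × Bool)}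

theorem mem_image_relabel_union (hleg : Function.Injective leg) {y : ι} {c : Bool} :
    (leg y, c) ∈ relabel leg p '' J ∪ C ↔ (y, xor c (p y)) ∈ J ∨ (leg y, c) ∈ C := by
  have hx : relabel leg p (y, xor c (p y)) = (leg y, c) := by simp [relabel]
  rw [Set.mem_union, ← hx, (relabel_injective hleg).mem_set_image]

theorem isFull_iff (hleg : Function.Injective leg) (hdis : Disjoint C D)
    (hst : ∀ y, HasKind b C D (leg y) (p y) (st y)) (hJ : J ⊆ groundOf st) {y : ι} :
    (∀ c, (leg y, c) ∈ relabel leg p '' J ∪ C) ↔ IsFull st J y := by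
  have h := hst y
  have hCD : ∀ x ∈ C, x ∉ D := fun x hx => Set.disjoint_left.1 hdis hx
  have hJ' : ∀ s, st y = Sum.inr s → (y, true) ∉ J := fun s hs h => by
    simpa using hJ h s hs
  simp only [mem_image_relabel_union hleg, IsFull]
  rcases hs : st y with τ | _ | _ <;> rw [hs] at h <;> simp only [HasKind, Set.mem_union] at h <;>
    simp only [Bool.forall_bool] at * <;> cases hp : p y <;> simp_all <;> grind

theorem isVacant_iff (hleg : Function.Injective leg) (hdis : Disjoint C D)
    (hst : ∀ y, HasKind b C D (leg y) (p y) (st y)) (hJ : J ⊆ groundOf st) {y : ι} :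
    (∀ c, (leg y, c) ∉ relabel leg p '' J ∪ C) ↔ IsVacant st J y := by
  have h := hst y
  have hCD : ∀ x ∈ C, x ∉ D := fun x hx => Set.disjoint_left.1 hdis hx
  have hJ' : ∀ s, st y = Sum.inr s → (y, true) ∉ J := fun s hs h => by
    simpa using hJ h s hs
  simp only [mem_image_relabel_union hleg, IsVacant]
  rcases hs : st y with τ | _ | _ <;> rw [hs] at h <;> simp only [HasKind, Set.mem_union] at h <;>
    simp only [Bool.forall_bool] at * <;> cases hp : p y <;> simp_all <;> grind

theorem mem_image_relabel_union_of_notMem_range {i : I} (hi : i ∉ Set.range leg) {c : Bool} :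
    (i, c) ∈ relabel leg p '' J ∪ C ↔ (i, c) ∈ C := by
  refine ⟨?_, Or.inr⟩
  rintro (⟨x, -, hx⟩ | h)
  · exact absurd ⟨x.1, congrArg Prod.fst hx⟩ hi
  · exact h

theorem mem_range_of_notMem (hran : ∀ i, i ∉ Set.range leg → ∀ c, (i, c) ∈ C ∪ D) {i : I}
    {c : Bool} (h : (i, c) ∉ C ∪ D) : ∃ y, leg y = i := by
  by_contra hi
  exact h (hran i hi c)

/-- The independent sets of a minor of a spike, in terms of the kinds of its legs. -/
theorem indep_image_relabel_iff (hleg : Function.Injective leg) (hdis : Disjoint C D)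
    (hst : ∀ y, HasKind b C D (leg y) (p y) (st y))
    (hran : ∀ i, i ∉ Set.range leg → ∀ c, (i, c) ∈ C ∪ D)
    (hC : ∀ i i', (∀ c, (i, c) ∈ C) → (∀ c, (i', c) ∈ C) → i = i')
    (hJ : J ⊆ groundOf st) (A : Set (Fin (m + 1))) :
    (((∀ i i', (∀ c, (i, c) ∈ relabel leg p '' J ∪ C) →
          (∀ c, (i', c) ∈ relabel leg p '' J ∪ C) → i = i') ∧
        ∃ i, ∀ c, (i, c) ∉ relabel leg p '' J ∪ C) ∨
      ((∀ i, ¬(∀ c, (i, c) ∈ relabel leg p '' J ∪ C) ∧ ¬∀ c, (i, c) ∉ relabel leg p '' J ∪ C) ∧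
        ∀ j ∈ A, ∃ i, (i, b j i) ∉ relabel leg p '' J ∪ C)) ↔
    ModelIndep st (∃ i, ∀ c, (i, c) ∈ C) (∃ i, ∀ c, (i, c) ∈ D)
      {j | j ∈ A ∧ ∀ i, (i, b j i) ∉ D ∧ (i, !b j i) ∉ C} J := by
  set K := relabel leg p '' J ∪ C with hK
  have hfull : ∀ y, (∀ c, (leg y, c) ∈ K) ↔ IsFull st J y := fun y =>
    isFull_iff hleg hdis hst hJ
  have hvac : ∀ y, (∀ c, (leg y, c) ∉ K) ↔ IsVacant st J y := fun y =>
    isVacant_iff hleg hdis hst hJ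
  -- A vanished leg is full only if wholly contracted and, below, empty only if wholly deleted. A
  -- leg with one element contracted and one deleted meets `K` once and enters only through the
  -- surviving transversals.
  have hfull' : ∀ i, (∀ c, (i, c) ∈ K) ↔ (∃ y, leg y = i ∧ IsFull st J y) ∨ ∀ c, (i, c) ∈ C := by
    intro i
    constructor
    · intro h
      by_cases hi : i ∈ Set.range leg
      · obtain ⟨y, rfl⟩ := hi
        exact Or.inl ⟨y, rfl, (hfull y).1 h⟩
      · exact Or.inr fun c => (mem_image_relabel_union_of_notMem_range hi).1 (h c)
    · rintro (⟨y, rfl, h⟩ | h) c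
      · exact (hfull y).2 h c
      · exact Or.inr (h c)
  have hnotleg : ∀ (E : Set (I × Bool)) (y : ι), E ⊆ C ∪ D → ¬∀ c, (leg y, c) ∈ E := by
    intro E y hE h
    have := hst y
    rcases hs : st y with τ | _ | _ <;> rw [hs] at this
    · exact this.1 true (hE (h _))
    · exact this.1 (hE (h _))
    · exact this.1 (hE (h _))
  have hvac' : ∀ i, (∀ c, (i, c) ∉ K) ↔ (∃ y, leg y = i ∧ IsVacant st J y) ∨ ∀ c, (i, c) ∈ D := by
    intro i
    constructor
    · intro h
      by_cases hi : i ∈ Set.range leg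
      · obtain ⟨y, rfl⟩ := hi
        exact Or.inl ⟨y, rfl, (hvac y).1 h⟩
      · refine Or.inr fun c => (hran i hi c).resolve_left fun hc => h c (Or.inr hc)
    · rintro (⟨y, rfl, h⟩ | h) c
      · exact (hvac y).2 h c
      · have hi : i ∉ Set.range leg := by
          rintro ⟨y, rfl⟩
          exact hnotleg D y Set.subset_union_right h
        rw [mem_image_relabel_union_of_notMem_range hi]
        exact fun hc => Set.disjoint_left.1 hdis hc (h c)
  have hnotC := fun y => hnotleg C y Set.subset_union_left
  refine or_congr ?_ ?_
  · simp only [hfull', hvac']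
    constructor
    · rintro ⟨hu, i, hi⟩
      refine ⟨?_, fun y y' hy hy' => hleg (hu _ _ (Or.inl ⟨y, rfl, hy⟩) (Or.inl ⟨y', rfl, hy'⟩)),
        ?_⟩
      · rintro ⟨i, hi⟩ y hy
        obtain rfl := hu i _ (Or.inr hi) (Or.inl ⟨y, rfl, hy⟩)
        exact hnotC y hi
      · rcases hi with ⟨y, -, hy⟩ | hi
        · exact Or.inr ⟨y, hy⟩
        · exact Or.inl ⟨i, hi⟩
    · rintro ⟨h1, h2, h3⟩
      refine ⟨?_, ?_⟩
      · rintro i i' (⟨y, rfl, hy⟩ | hi) (⟨y', rfl, hy'⟩ | hi')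
        · rw [h2 y y' hy hy']
        · exact absurd hy (h1 ⟨i', hi'⟩ y)
        · exact absurd hy' (h1 ⟨i, hi⟩ y')
        · exact hC i i' hi hi'
      · rcases h3 with ⟨i, hi⟩ | ⟨y, hy⟩
        · exact ⟨i, Or.inr hi⟩
        · exact ⟨leg y, Or.inl ⟨y, rfl, hy⟩⟩
  · have hone : (∀ i, ¬(∀ c, (i, c) ∈ K) ∧ ¬∀ c, (i, c) ∉ K) ↔
        (¬∃ i, ∀ c, (i, c) ∈ C) ∧ (¬∃ i, ∀ c, (i, c) ∈ D) ∧
          ∀ y, ¬IsFull st J y ∧ ¬IsVacant st J y := by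
      simp only [hfull', hvac']
      constructor
      · intro h
        exact ⟨fun ⟨i, hi⟩ => (h i).1 (Or.inr hi), fun ⟨i, hi⟩ => (h i).2 (Or.inr hi),
          fun y => ⟨fun hy => (h _).1 (Or.inl ⟨y, rfl, hy⟩),
            fun hy => (h _).2 (Or.inl ⟨y, rfl, hy⟩)⟩⟩
      · rintro ⟨h1, h2, h3⟩ i
        refine ⟨?_, ?_⟩
        · rintro (⟨y, -, hy⟩ | hi)
          · exact (h3 y).1 hy
          · exact h1 ⟨i, hi⟩
        · rintro (⟨y, -, hy⟩ | hi)
          · exact (h3 y).2 hy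
          · exact h2 ⟨i, hi⟩
    rw [← and_assoc, ← and_assoc, and_assoc (a := ¬∃ i, ∀ c, (i, c) ∈ C), ← hone]
    refine and_congr_right fun h1 => ?_
    have hlabel : ∀ {y τ} j, st y = Sum.inl τ →
        ((leg y, b j (leg y)) ∈ K ↔
          (y, (Fin.cons false τ : Fin (m + 1) → Bool) j) ∈ J) := by
      intro y τ j hy
      have h := hst y
      rw [hy] at h
      rw [hK, mem_image_relabel_union hleg, h.2 j, Bool.xor_assoc, Bool.xor_self, Bool.xor_false]
      exact or_iff_left fun h' => h.1 _ (Or.inl h')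
    have hother : ∀ {i c}, (i, c) ∉ K → (i, !c) ∈ K := by
      intro i c hc
      by_contra h
      refine (h1 i).2 fun d => ?_
      have : d = c ∨ d = !c := by cases d <;> cases c <;> simp
      rcases this with rfl | rfl
      · exact hc
      · exact h
    have hother' : ∀ {i c}, (i, !c) ∈ K → (i, c) ∉ K := by
      intro i c hc h
      refine (h1 i).1 fun d => ?_
      have : d = c ∨ d = !c := by cases d <;> cases c <;> simp
      rcases this with rfl | rfl
      · exact h
      · exact hc
    constructor
    · rintro h j ⟨hjA, hj⟩
      obtain ⟨i, hi⟩ := h j hjA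
      have hi1 : (i, b j i) ∉ C ∪ D := by
        rintro (h' | h')
        · exact hi (Or.inr h')
        · exact (hj i).1 h'
      obtain ⟨y, rfl⟩ := mem_range_of_notMem hran hi1
      -- The twin of the missing element lies in `K` but not in `C`, so it comes from `J` and
      -- survives; the leg is therefore whole.
      have hi2 : (leg y, !b j (leg y)) ∉ C ∪ D := by
        have h2 := (hother hi).resolve_right (hj _).2
        have h3 : relabel leg p '' J ⊆ (C ∪ D)ᶜ := by
          rw [← image_relabel_groundOf hst hran]
          exact Set.image_mono hJ
        exact h3 h2
      have hboth : ∀ c, (leg y, c) ∉ C ∪ D := by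
        intro c
        have : c = b j (leg y) ∨ c = !b j (leg y) := by
          cases c <;> cases b j (leg y) <;> simp
        rcases this with rfl | rfl
        · exact hi1
        · exact hi2
      rcases hs : st y with τ | s
      · exact ⟨y, τ, hs, fun h' => hi ((hlabel j hs).2 h')⟩
      · have h := hst y
        rw [hs] at h
        cases s
        · exact absurd (Or.inl h.2) (hboth _)
        · exact absurd (Or.inr h.2) (hboth _)
    · intro h j hjA
      by_cases hj : ∀ i, (i, b j i) ∉ D ∧ (i, !b j i) ∉ C
      · obtain ⟨y, τ, hs, hy⟩ := h j ⟨hjA, hj⟩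
        exact ⟨leg y, fun h' => hy ((hlabel j hs).1 h')⟩
      -- A destroyed transversal imposes nothing: it has an element that is deleted or whose twin is
      -- contracted, and `K` avoids that element.
      · push Not at hj
        obtain ⟨i, hi⟩ := hj
        refine ⟨i, ?_⟩
        by_cases hD : (i, b j i) ∈ D
        · rintro (h' | h')
          · have h3 : relabel leg p '' J ⊆ (C ∪ D)ᶜ := by
              rw [← image_relabel_groundOf hst hran]
              exact Set.image_mono hJ
            exact h3 h' (Or.inr hD)
          · exact Set.disjoint_left.1 hdis h' hD
        · exact hother' (Or.inr (hi hD))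

end Relabel
end Model

/-! ### Counting isomorphism types -/

theorem exists_sigma_fin_equiv {S K : Type*} [Finite S] (s : S → K) :
    ∃ e : (Σ k, Fin (Nat.card {i : S // s i = k})) ≃ S, ∀ y, s (e y) = y.1 :=
  ⟨(Equiv.sigmaCongrRight fun _ => (Finite.equivFin _).symm).trans (Equiv.sigmaFiberEquiv s),
    fun y => ((Finite.equivFin _).symm y.2).2⟩

/-- Contract only a basis of the contracted set: its other elements become loops, so deleting them
has the same effect as contracting them. -/
theorem exists_contract_indep_delete_eq {α : Type*} {L N : Matroid α} (h : N.IsMinor L) :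
    ∃ C D, L.Indep C ∧ Disjoint C D ∧ N.E = L.E \ (C ∪ D) ∧
      ∀ J ⊆ N.E, (N.Indep J ↔ L.Indep (J ∪ C)) := by
  obtain ⟨C₀, D₀, rfl⟩ := h
  obtain ⟨C, hC⟩ := L.exists_isBasis' C₀
  refine ⟨C, (C₀ \ C ∪ D₀) \ C, hC.indep, Set.disjoint_sdiff_right, ?_, fun J hJ => ?_⟩
  · rw [hC.contract_eq_contract_delete, Matroid.delete_delete, Matroid.delete_ground,
      Matroid.contract_ground, Set.sdiff_sdiff, Set.union_sdiff_self]
  · rw [hC.contract_eq_contract_delete, Matroid.delete_delete] at hJ ⊢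
    rw [Matroid.delete_ground, Matroid.contract_ground, Set.subset_sdiff, Set.subset_sdiff] at hJ
    rw [Matroid.delete_indep_iff, hC.indep.contract_indep_iff]
    tauto

/-- Every member of `S_{m+1}` with at most `n` elements is isomorphic to a model with legs numbered
kind by kind. -/
theorem MemS.exists_model {m n : ℕ} {α : Type*} {M : Matroid α} (h : MemS (m + 1) M)
    (hn : Nat.card M.E ≤ n) :
    ∃ (q₁ q₂ : Prop) (A : Set (Fin (m + 1))) (cnt : LegKind m → Fin (n + 1))
      (f : M.E ≃ groundOf (fun y : Σ s, Fin (cnt s) => y.1)), ∀ I : Set M.E,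
      M.Indep (Subtype.val '' I) ↔
        ModelIndep (fun y : Σ s, Fin (cnt s) => y.1) q₁ q₂ A (Subtype.val '' (f '' I)) := by
  obtain ⟨r, L, N, hL, hNL, g, hg⟩ := h
  have hr : NeZero r := ⟨by have := hL.1; omega⟩
  obtain ⟨b, A, hind⟩ := hL.exists_indep_iff
  have hLE : L.E = Set.univ := by
    obtain ⟨-, B, -, -, -, h⟩ := hL
    exact h.1
  obtain ⟨C, D, hCi, hdis, hNE, hN⟩ := exists_contract_indep_delete_eq hNL
  have hNE' : N.E = (C ∪ D)ᶜ := by rw [hNE, hLE, Set.compl_eq_univ_sdiff]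
  have hCuniq : ∀ i i', (∀ c, (i, c) ∈ C) → (∀ c, (i', c) ∈ C) → i = i' := by
    rcases (hind C).1 hCi with h | h
    · exact h.1
    · exact fun i _ hi => absurd hi (h.1 i).1
  let S : Set (ZMod r) := {i | ∃ c, (i, c) ∉ C ∪ D}
  have hkind : ∀ i : S, ∃ p s, HasKind b C D i.1 p s := fun i => exists_hasKind b C D i.1 i.2
  choose p s hps using hkind
  obtain ⟨e, he⟩ := exists_sigma_fin_equiv s
  have hmem : ∀ i : S, (i.1, p i) ∈ N.E := by
    intro i
    have := hps i
    rw [hNE']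
    rcases hs : s i with τ | _ | _ <;> rw [hs] at this
    · exact this.1 _
    · exact this.1
    · exact this.1
  have hfinE : Finite N.E := Set.toFinite _
  -- Each leg counted keeps at least one element of `N`, so there are at most `n` of them.
  have hcnt : ∀ k, Nat.card {i : S // s i = k} < n + 1 := by
    intro k
    refine Nat.lt_succ_of_le (le_trans ?_ hn)
    rw [Nat.card_congr g]
    refine Nat.card_le_card_of_injective
      (fun i : {i : S // s i = k} => (⟨(i.1.1, p i.1), hmem i.1⟩ : N.E)) fun i j hij => ?_
    exact Subtype.ext (Subtype.ext (congrArg (fun x : N.E => x.1.1) hij))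
  let cnt : LegKind m → Fin (n + 1) := fun k => ⟨_, hcnt k⟩
  let leg : (Σ k, Fin (cnt k)) → ZMod r := fun y => (e y).1
  let st : (Σ k, Fin (cnt k)) → LegKind m := fun y => y.1
  have hleg : Function.Injective leg := Subtype.val_injective.comp e.injective
  have hst : ∀ y, HasKind b C D (leg y) (p (e y)) (st y) := by
    intro y
    have := hps (e y)
    rwa [he y] at this
  have hran : ∀ i, i ∉ Set.range leg → ∀ c, (i, c) ∈ C ∪ D := by
    intro i hi c
    by_contra hc
    exact hi ⟨e.symm ⟨i, c, hc⟩, by simp [leg]⟩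
  have himg := image_relabel_groundOf hst hran
  let F : groundOf st ≃ N.E :=
    (Equiv.Set.image _ (groundOf st) (relabel_injective (p := fun y => p (e y)) hleg)).trans
      (Equiv.setCongr (himg.trans hNE'.symm))
  have hF : ∀ x, (F x : ZMod r × Bool) = relabel leg (fun y => p (e y)) x.1 := fun x => rfl
  refine ⟨∃ i, ∀ c, (i, c) ∈ C, ∃ i, ∀ c, (i, c) ∈ D,
    {j | j ∈ A ∧ ∀ i, (i, b j i) ∉ D ∧ (i, !b j i) ∉ C}, cnt, g.trans F.symm, fun I => ?_⟩
  have hJ : Subtype.val '' ((g.trans F.symm) '' I) ⊆ groundOf st := by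
    rintro _ ⟨x, -, rfl⟩
    exact x.2
  rw [hg]
  have hrel : (Subtype.val '' (g '' I) : Set (ZMod r × Bool)) =
      relabel leg (fun y => p (e y)) '' (Subtype.val '' ((g.trans F.symm) '' I)) := by
    simp only [Set.image_image]
    refine Set.image_congr fun x _ => ?_
    rw [← hF]
    simp
  rw [hN _ (by rintro _ ⟨x, -, rfl⟩; exact x.2), hind, hrel]
  exact indep_image_relabel_iff hleg hdis hst hran hCuniq hJ A

/-- The code consists of two propositions, a subset of m + 1 indices, and 2^m + 2 counts in {0, …,
n}; matroids with equal codes share a model. -/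
theorem numS_succ_le (m n : ℕ) :
    numS (m + 1) n ≤ 2 ^ (m + 3) * (n + 1) ^ (2 ^ m + 2) := by
  have hmodel : ∀ M : LabelledS (m + 1) n, _ := fun M =>
    M.2.2.exists_model (m := m) (n := n) (by rw [M.2.1]; simp)
  choose q₁ q₂ A cnt f hf using hmodel
  have hiso : ∀ M M', q₁ M = q₁ M' → q₂ M = q₂ M' → A M = A M' → cnt M = cnt M' →
      Isomorphic M.1 M'.1 := by
    intro M M' h1 h2 h3 h4
    have hM := hf M
    generalize f M = g at hM
    rw [h1, h2, h3] at hM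
    clear h1 h2 h3
    -- The ground set of the model depends on the counts, so these must be identified before the two
    -- bijections can be composed.
    generalize cnt M = d at g hM h4
    subst h4
    refine ⟨g.trans (f M').symm, fun I => ?_⟩
    rw [hM, hf M']
    simp only [Set.image_image]
    simp
  let code : Quotient (isoSetoid (m + 1) n) →
      Prop × Prop × Set (Fin (m + 1)) × (LegKind m → Fin (n + 1)) :=
    fun x => (q₁ x.out, q₂ x.out, A x.out, cnt x.out)
  have hcode : Function.Injective code := by
    intro x y hxy
    simp only [code, Prod.mk.injEq] at hxy
    rw [← x.out_eq, ← y.out_eq]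
    exact Quotient.sound (hiso _ _ hxy.1 hxy.2.1 hxy.2.2.1 hxy.2.2.2)
  refine (Nat.card_le_card_of_injective code hcode).trans (le_of_eq ?_)
  simp only [Nat.card_eq_fintype_card, Fintype.card_prod, Fintype.card_prop, Fintype.card_set,
    Fintype.card_fin, Fintype.card_fun, Fintype.card_sum, Fintype.card_bool]
  ring

end SpikeMinors

theorem lemma3p11 (k : ℕ) (hk : 1 ≤ k) :
    (fun t : ℕ => (SpikeMinors.numS k (2 * t) : ℝ)) =O[Filter.atTop]
      (fun t : ℕ => (t : ℝ) ^ (2 ^ (k - 1) + 2)) := by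
  obtain ⟨m, rfl⟩ := Nat.exists_eq_add_of_le' hk
  rw [Nat.add_sub_cancel]
  -- The factor 3 comes from 2t + 1 ≤ 3t for t ≥ 1.
  refine Asymptotics.IsBigO.of_bound (2 ^ (m + 3) * 3 ^ (2 ^ m + 2)) ?_
  filter_upwards [Filter.eventually_ge_atTop 1] with t ht
  rw [Real.norm_of_nonneg (by positivity), Real.norm_of_nonneg (by positivity)]
  calc (SpikeMinors.numS (m + 1) (2 * t) : ℝ)
      ≤ 2 ^ (m + 3) * ((2 * t + 1 : ℕ) : ℝ) ^ (2 ^ m + 2) := by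
        exact_mod_cast SpikeMinors.numS_succ_le m (2 * t)
    _ ≤ 2 ^ (m + 3) * (3 * (t : ℝ)) ^ (2 ^ m + 2) := by
        gcongr
        exact_mod_cast (by omega : 2 * t + 1 ≤ 3 * t)
    _ = 2 ^ (m + 3) * 3 ^ (2 ^ m + 2) * (t : ℝ) ^ (2 ^ m + 2) := by
        rw [mul_pow, mul_assoc]
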